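/- For $n\ge 1$ let $|\psi\rangle\in(\mathbb C^2)^{\otimes n}$ denote an $n$-qubit state (a unit vector) and let $|\overline\psi\rangle$ be its entrywise complex conjugate in the computational basis. Consider the problem of deciding whether $|\langle\psi|\overline\psi\rangle|\ge 2/3$ or $|\langle\psi|\overline\psi\rangle|\le 1/3$, promised that one of the two holds. A quantum algorithm is an arbitrary two-outcome measurement (POVM) on its input register; it solves the problem with success probability $p$ if on every $\psi$ satisfying the promise it gives the correct answer with probability at least $p$. (1) Any algorithm that uses only copies of $|\psi\rangle$ needs $\Omega(2^{n/2})$ copies: for every constant $p>1/2$ there is a constant $c>0$ such that, for all $n\ge 1$ and $k\ge 0$, if some algorithm with input $|\psi\rangle^{\otimes k}$ solves the problem with success probability $p$, then $k\ge c\,2^{n/2}$. (2) One copy of $|\psi\rangle\otimes|\overline\psi\rangle$ suffices for constant success probability, via the swap test: there are constants $p>1/2$ and $s,t\in[0,1]$, independent of $n$, such that for every $n$ the algorithm that runs the swap test once on $|\psi\rangle\otimes|\overline\psi\rangle$ and answers "$|\langle\psi|\overline\psi\rangle|\ge 2/3$" with probability $s$ if the test passes and with probability $t$ if it fails solves the problem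 with success probability $p$. -/

import Mathlib

open scoped Kronecker ComplexOrder

namespace ConjOverlap

/-- Labels of the computational basis of `n` qubits: bit strings of length `n`. -/
abbrev Bits (n : ℕ) : Type := Fin n → Fin 2

/-- State vectors of a register with computational basis labelled by `ι`. -/
abbrev Ket (ι : Type) : Type := EuclideanSpace ℂ ι

/-- The entrywise complex conjugate of a vector in the computational basis. -/
noncomputable def conjKet {ι : Type} (ψ : Ket ι) : Ket ι :=
  WithLp.toLp 2 fun x => starRingEnd ℂ (ψ x)

/-- The tensor product of two vectors. -/
noncomputable def tensorKet {ι κ : Type} (φ : Ket ι) (χ : Ket κ) : Ket (ι × κ) :=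
  WithLp.toLp 2 fun x => φ x.1 * χ x.2

/-- The tensor power: `k` copies of `ψ`. -/
noncomputable def copies {ι : Type} (k : ℕ) (ψ : Ket ι) : Ket (Fin k → ι) :=
  WithLp.toLp 2 fun x => ∏ i, ψ (x i)

/-- A quantum decision algorithm on a register with basis `ι`, as a general two-outcome quantum
measurement (POVM) with elements `yes` and `1 - yes`. By dilation this is the same as any
procedure that adjoins ancillas, applies quantum operations (possibly adaptive and with
randomness) and measures at the end; no bound is put on its computational cost. -/
structure Algorithm (ι : Type) [Fintype ι] [DecidableEq ι] where
  yes : Matrix ι ι ℂ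
  yes_nonneg : yes.PosSemidef
  yes_le_one : (1 - yes).PosSemidef

/-- The Born probability `⟨φ|E|φ⟩` of the measurement outcome with effect `E` on the state `φ`. -/
noncomputable def bornProb {ι : Type} [Fintype ι] [DecidableEq ι]
    (E : Matrix ι ι ℂ) (φ : Ket ι) : ℝ :=
  (inner ℂ φ (Matrix.toEuclideanLin E φ)).re

/-- The algorithm `A`, run on the input state `input ψ`, decides with success probability at
least `p` whether `|⟨ψ|ψ̄⟩| ≥ 2/3` (answer yes) or `|⟨ψ|ψ̄⟩| ≤ 1/3` (answer no), for every
`n`-qubit state `ψ` that satisfies one of the two. -/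
def Solves {n : ℕ} {ι : Type} [Fintype ι] [DecidableEq ι] (A : Algorithm ι)
    (input : Ket (Bits n) → Ket ι) (p : ℝ) : Prop :=
  ∀ ψ : Ket (Bits n), ‖ψ‖ = 1 →
    (2 / 3 ≤ ‖inner ℂ ψ (conjKet ψ)‖ → p ≤ bornProb A.yes (input ψ)) ∧
    (‖inner ℂ ψ (conjKet ψ)‖ ≤ 1 / 3 → p ≤ bornProb (1 - A.yes) (input ψ))

/-- The one-qubit Hadamard gate. -/
noncomputable def hadamard : Matrix (Fin 2) (Fin 2) ℂ :=
  ((Real.sqrt 2 : ℝ) : ℂ)⁻¹ • !![1, 1; 1, -1]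

/-- The swap operator `|x, y⟩ ↦ |y, x⟩` on two registers of the same kind. -/
def swapGate (ι : Type) [DecidableEq ι] : Matrix (ι × ι) (ι × ι) ℂ :=
  Matrix.of fun a b => if a = b.swap then 1 else 0

/-- The swap gate on two registers, controlled by a qubit. -/
def controlledSwap (ι : Type) [DecidableEq ι] :
    Matrix (Fin 2 × (ι × ι)) (Fin 2 × (ι × ι)) ℂ :=
  !![1, 0; 0, 0] ⊗ₖ (1 : Matrix (ι × ι) (ι × ι) ℂ) + !![0, 0; 0, 1] ⊗ₖ swapGate ι

/-- The circuit of the swap test: Hadamard gate on the control qubit, controlled swap,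
Hadamard gate on the control qubit. -/
noncomputable def swapTestCircuit (ι : Type) [Fintype ι] [DecidableEq ι] :
    Matrix (Fin 2 × (ι × ι)) (Fin 2 × (ι × ι)) ℂ :=
  (hadamard ⊗ₖ (1 : Matrix (ι × ι) (ι × ι) ℂ)) * controlledSwap ι *
    (hadamard ⊗ₖ (1 : Matrix (ι × ι) (ι × ι) ℂ))

/-- The effect on the two registers of the event that the swap test passes, that is, that the
control qubit, prepared in `|0⟩`, is measured to be `0` at the end of the circuit `U`:
the compression of `U† (|0⟩⟨0| ⊗ 1) U` to the subspace where the control qubit is `|0⟩`. -/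
noncomputable def swapTestPass (ι : Type) [Fintype ι] [DecidableEq ι] :
    Matrix (ι × ι) (ι × ι) ℂ :=
  ((swapTestCircuit ι).conjTranspose *
    ((!![1, 0; 0, 0] : Matrix (Fin 2) (Fin 2) ℂ) ⊗ₖ (1 : Matrix (ι × ι) (ι × ι) ℂ)) *
      swapTestCircuit ι).submatrix (fun a => (0, a)) (fun a => (0, a))

/-- The swap test passes with the effect `(1 + SWAP) / 2`. -/
theorem swapTestPass_eq (ι : Type) [Fintype ι] [DecidableEq ι] :
    swapTestPass ι = (1 / 2 : ℂ) • (1 + swapGate ι) := by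
  have h2 : ((Real.sqrt 2 : ℝ) : ℂ)⁻¹ * ((Real.sqrt 2 : ℝ) : ℂ)⁻¹ = 1 / 2 := by
    rw [← mul_inv, ← Complex.ofReal_mul, Real.mul_self_sqrt (by norm_num)]; norm_num
  have h0 : hadamard * !![1, 0; 0, 0] * hadamard = (1 / 2 : ℂ) • !![1, 1; 1, 1] := by
    unfold hadamard
    rw [smul_mul_assoc, smul_mul_assoc, mul_smul_comm, smul_smul, h2]
    simp
  have h1 : hadamard * !![0, 0; 0, 1] * hadamard = (1 / 2 : ℂ) • !![1, -1; -1, 1] := by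
    unfold hadamard
    rw [smul_mul_assoc, smul_mul_assoc, mul_smul_comm, smul_smul, h2]
    simp
  have hs : (swapGate ι).conjTranspose = swapGate ι := by
    ext a b
    have : b = a.swap ↔ a = b.swap := by constructor <;> (rintro rfl; simp)
    simp [swapGate, this, apply_ite]
  have hss : swapGate ι * swapGate ι = 1 := by
    ext a b
    simp [swapGate, Matrix.mul_apply, Matrix.one_apply]
  have hU : swapTestCircuit ι = ((1 / 2 : ℂ) • !![1, 1; 1, 1]) ⊗ₖ 1 +
      ((1 / 2 : ℂ) • !![1, -1; -1, 1]) ⊗ₖ swapGate ι := by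
    unfold swapTestCircuit controlledSwap
    rw [mul_add, add_mul]
    simp only [← Matrix.mul_kronecker_mul, one_mul, mul_one, h0, h1]
  unfold swapTestPass
  rw [hU]
  simp only [Matrix.conjTranspose_add, Matrix.conjTranspose_kronecker, mul_add, add_mul,
    ← Matrix.mul_kronecker_mul, hs, hss, Matrix.conjTranspose_one, one_mul, mul_one]
  ext a b
  have h3 : (starRingEnd ℂ) 2 = 2 := map_ofNat _ 2
  simp [Matrix.mul_apply, Fin.sum_univ_two, Matrix.conjTranspose_apply, h3]
  ring

/-- The algorithm `A` runs the swap test once and then answers yes with probability `s` if the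
test passes and with probability `t` if it fails. -/
def IsSwapTestAlgorithm {ι : Type} [Fintype ι] [DecidableEq ι] (A : Algorithm (ι × ι))
    (s t : ℝ) : Prop :=
  A.yes = (s : ℂ) • swapTestPass ι + (t : ℂ) • (1 - swapTestPass ι)

end ConjOverlap

/-! Lower bound: put `d = 2 ^ n` and take states with amplitudes `c x * ε x / √d`, with unit phases
`c` and random signs `ε`. The overlap with the conjugate is `|∑ c x ^ 2| / d`, whatever the signs:
it is 1 for `c = 1` and 0 for phases 1 and `i` in equal number. Averaging `k` copies over the signs
kills every density matrix entry `(x, y)` unless each label occurs in `x` and `y` with equal parity.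
If `x` or `y` has no repetition, this forces them to be rearrangements of each other, and the phases
cancel (`sum_phaseKet_copies_eq`). So the two mixtures differ only on tuples with a repetition,
which by the birthday bound have weight at most `k ^ 2 / d` (`norm_sq_repeatPart_le`). Hence `2 * p
- 1 ≤ k ^ 2 / d`.

Upper bound: the swap test passes with probability `(1 + |⟨ψ|ψ̄⟩|²) / 2`, and the promise leaves a
constant gap. -/

set_option linter.unusedSectionVars false

namespace ConjOverlap

/-! ### Born probabilities of effects -/

section Born

variable {ι : Type} [Fintype ι] [DecidableEq ι]

theorem inner_toEuclideanLin (E : Matrix ι ι ℂ) (φ : Ket ι) :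
    inner ℂ φ (Matrix.toEuclideanLin E φ) =
      ∑ x, ∑ y, E x y * (starRingEnd ℂ (φ x) * φ y) := by
  simp only [PiLp.inner_apply, RCLike.inner_apply, Matrix.toLpLin_apply, Matrix.mulVec,
    dotProduct, Finset.sum_mul]
  refine Finset.sum_congr rfl fun x _ => Finset.sum_congr rfl fun y _ => ?_
  ring

theorem bornProb_nonneg {E : Matrix ι ι ℂ} (hE : E.PosSemidef) (φ : Ket ι) :
    0 ≤ bornProb E φ := by
  have h := hE.dotProduct_mulVec_nonneg (φ : ι → ℂ)
  have h2 : inner ℂ φ (Matrix.toEuclideanLin E φ) = star (φ : ι → ℂ) ⬝ᵥ E.mulVec φ := by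
    rw [inner_toEuclideanLin]
    simp only [Matrix.mulVec, dotProduct, Finset.mul_sum, Pi.star_apply, RCLike.star_def]
    refine Finset.sum_congr rfl fun x _ => Finset.sum_congr rfl fun y _ => ?_
    ring
  rw [bornProb, h2]
  exact (Complex.le_def.1 h).1

theorem bornProb_one_sub (E : Matrix ι ι ℂ) (φ : Ket ι) :
    bornProb (1 - E) φ = ‖φ‖ ^ 2 - bornProb E φ := by
  have h1 : Matrix.toEuclideanLin (1 : Matrix ι ι ℂ) φ = φ := by
    ext x; simp
  simp only [bornProb, map_sub, LinearMap.sub_apply, inner_sub_right, Complex.sub_re, h1]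
  rw [inner_self_eq_norm_sq_to_K]
  norm_cast

theorem Algorithm.bornProb_le (A : Algorithm ι) (φ : Ket ι) :
    bornProb A.yes φ ≤ ‖φ‖ ^ 2 := by
  have h := bornProb_nonneg A.yes_le_one φ
  rw [bornProb_one_sub] at h
  linarith

/-- A mixture is seen by a measurement only through its density matrix, so comparing mixtures
reduces to comparing matrix entries. -/
theorem sum_bornProb {α : Type} [Fintype α] (E : Matrix ι ι ℂ) (φ : α → Ket ι) :
    ∑ a, bornProb E (φ a) =
      (∑ x, ∑ y, E x y * ∑ a, starRingEnd ℂ (φ a x) * φ a y).re := by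
  simp only [bornProb, inner_toEuclideanLin, ← Complex.re_sum]
  congr 1
  rw [Finset.sum_comm]
  refine Finset.sum_congr rfl fun x _ => ?_
  rw [Finset.sum_comm]
  refine Finset.sum_congr rfl fun y _ => ?_
  rw [Finset.mul_sum]

end Born

/-! ### Mixtures of random sign states and the birthday bound -/

section Signs

variable {ι : Type} [Fintype ι] [DecidableEq ι] {k : ℕ}

/-- The number of times that `z` occurs in the tuple `x`. -/
def occ (x : Fin k → ι) (z : ι) : ℕ := (Finset.univ.filter fun j => x j = z).card

theorem sum_occ (x : Fin k → ι) : ∑ z, occ x z = k := by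
  have h := Finset.card_eq_sum_card_fiberwise (f := x) (s := Finset.univ) (t := Finset.univ)
    (fun _ _ => Finset.mem_coe.2 (Finset.mem_univ _))
  simpa [occ] using h.symm

theorem occ_le_one_iff (x : Fin k → ι) : (∀ z, occ x z ≤ 1) ↔ Function.Injective x := by
  simp only [occ, Finset.card_le_one, Finset.mem_filter, Finset.mem_univ, true_and]
  constructor
  · intro h i j hij
    exact h (x j) i hij j rfl
  · rintro h z i rfl j hj
    exact (h hj).symm

theorem prod_eq_prod_pow_occ (c : ι → ℂ) (x : Fin k → ι) :
    ∏ j, c (x j) = ∏ z, c z ^ occ x z := by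
  rw [← Finset.prod_fiberwise_of_maps_to (g := x) (t := Finset.univ)
    (fun _ _ => Finset.mem_univ _)]
  refine Finset.prod_congr rfl fun z _ => ?_
  rw [occ, ← Finset.prod_const]
  refine Finset.prod_congr rfl fun j hj => ?_
  rw [(Finset.mem_filter.1 hj).2]

/-- Injectivity makes every `occ x z` 0 or 1, so equal parity gives `occ x ≤ occ y` pointwise; both
sum to `k`, which forces equality. -/
theorem occ_eq_of_parity {x y : Fin k → ι} (hx : Function.Injective x)
    (h : ∀ z, (Even (occ x z) ↔ Even (occ y z))) : occ x = occ y := by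
  have hle : ∀ z ∈ Finset.univ, occ x z ≤ occ y z := by
    intro z _
    have h1 := (occ_le_one_iff x).2 hx z
    have h2 := h z
    rcases Nat.le_one_iff_eq_zero_or_eq_one.1 h1 with h0 | h0
    · omega
    · rw [h0] at h2 ⊢
      by_contra h3
      have : occ y z = 0 := by omega
      rw [this] at h2
      simp at h2
  have := (Finset.sum_eq_sum_iff_of_le hle).1 (by rw [sum_occ, sum_occ])
  funext z
  exact this z (Finset.mem_univ z)

/-- Flipping the sign at `z` permutes the sign patterns and negates every summand, as `occ x z + occ
y z` is odd. -/
theorem sum_signs_eq_zero {x y : Fin k → ι} {z : ι}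
    (h : ¬ (Even (occ x z) ↔ Even (occ y z))) :
    ∑ ε : ι → ℤˣ, (∏ j, ((ε (x j) : ℤ) : ℂ)) * ∏ j, ((ε (y j) : ℤ) : ℂ) = 0 := by
  have hflip : ∀ (ε : ι → ℤˣ) (u : Fin k → ι),
      ∏ j, ((((ε * Pi.mulSingle z (-1) : ι → ℤˣ) (u j) : ℤˣ) : ℤ) : ℂ) =
        (∏ j, ((ε (u j) : ℤ) : ℂ)) * (-1) ^ occ u z := by
    intro ε u
    have h1 : ∏ j, (if u j = z then (-1 : ℂ) else 1) = (-1) ^ occ u z := by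
      rw [Finset.prod_ite]; simp [occ]
    rw [← h1, ← Finset.prod_mul_distrib]
    refine Finset.prod_congr rfl fun j _ => ?_
    by_cases hj : u j = z
    · subst hj; simp
    · simp [hj]
  have hs := Equiv.sum_comp (Equiv.mulRight (Pi.mulSingle z (-1) : ι → ℤˣ))
    (fun ε => (∏ j, ((ε (x j) : ℤ) : ℂ)) * ∏ j, ((ε (y j) : ℤ) : ℂ))
  have hsign : ((-1 : ℂ) ^ occ x z) * (-1) ^ occ y z = -1 := by
    rw [← pow_add]
    refine Odd.neg_one_pow ?_
    rw [← Nat.not_even_iff_odd, Nat.even_add]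
    exact h
  simp only [Equiv.coe_mulRight, hflip] at hs
  have : ∀ ε : ι → ℤˣ, (∏ j, ((ε (x j) : ℤ) : ℂ)) * (-1) ^ occ x z *
      ((∏ j, ((ε (y j) : ℤ) : ℂ)) * (-1) ^ occ y z) =
      -((∏ j, ((ε (x j) : ℤ) : ℂ)) * ∏ j, ((ε (y j) : ℤ) : ℂ)) := by
    intro ε
    linear_combination ((∏ j, ((ε (x j) : ℤ) : ℂ)) * ∏ j, ((ε (y j) : ℤ) : ℂ)) * hsign
  simp only [this, Finset.sum_neg_distrib] at hs
  exact self_eq_neg.1 hs.symm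

/-- The state with uniform modulus, phases `c` and signs `ε`. -/
noncomputable def phaseKet (c : ι → ℂ) (ε : ι → ℤˣ) : Ket ι :=
  WithLp.toLp 2 fun x => ((Real.sqrt (Fintype.card ι))⁻¹ : ℂ) * (c x * ((ε x : ℤ) : ℂ))

theorem phaseKet_copies_apply (c : ι → ℂ) (ε : ι → ℤˣ) (x : Fin k → ι) :
    copies k (phaseKet c ε) x = ((Real.sqrt (Fintype.card ι))⁻¹ : ℂ) ^ k *
      ((∏ j, c (x j)) * ∏ j, ((ε (x j) : ℤ) : ℂ)) := by
  simp [copies, phaseKet, Finset.prod_mul_distrib]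

theorem norm_sign (u : ℤˣ) : ‖((u : ℤ) : ℂ)‖ = 1 := by
  rcases Int.units_eq_one_or u with rfl | rfl <;> simp

theorem norm_sq_phaseKet_copies_apply {c : ι → ℂ} (hc : ∀ x, ‖c x‖ = 1) (ε : ι → ℤˣ)
    (x : Fin k → ι) :
    ‖copies k (phaseKet c ε) x‖ ^ 2 = ((Fintype.card ι : ℝ) ^ k)⁻¹ := by
  rw [phaseKet_copies_apply]
  simp only [norm_mul, norm_pow, norm_prod, hc, norm_sign, norm_inv, Complex.norm_real]
  simp only [Finset.prod_const_one, mul_one, Real.norm_eq_abs, abs_of_nonneg (Real.sqrt_nonneg _)]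
  rw [← pow_mul, mul_comm, pow_mul, inv_pow, Real.sq_sqrt (Nat.cast_nonneg _), inv_pow]

theorem norm_phaseKet [Nonempty ι] {c : ι → ℂ} (hc : ∀ x, ‖c x‖ = 1) (ε : ι → ℤˣ) :
    ‖phaseKet c ε‖ = 1 := by
  have h : ∀ x, ‖phaseKet c ε x‖ ^ 2 = (Fintype.card ι : ℝ)⁻¹ := by
    intro x
    simpa [copies] using norm_sq_phaseKet_copies_apply (k := 1) hc ε (fun _ => x)
  rw [EuclideanSpace.norm_eq, Finset.sum_congr rfl fun x _ => h x]
  simp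

/-- The signs square to 1 and drop out, so averaging over them never leaves one side of the promise.
-/
theorem inner_conjKet_phaseKet (c : ι → ℂ) (ε : ι → ℤˣ) :
    inner ℂ (phaseKet c ε) (conjKet (phaseKet c ε)) =
      (Fintype.card ι : ℂ)⁻¹ * starRingEnd ℂ (∑ x, c x ^ 2) := by
  have h1 : (((Real.sqrt (Fintype.card ι) : ℝ) : ℂ)⁻¹) ^ 2 = (Fintype.card ι : ℂ)⁻¹ := by
    rw [inv_pow, ← Complex.ofReal_pow, Real.sq_sqrt (Nat.cast_nonneg _)]; simp
  simp only [PiLp.inner_apply, RCLike.inner_apply, conjKet, phaseKet, map_sum, Finset.mul_sum,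
    map_mul, map_inv₀, Complex.conj_ofReal, map_intCast, map_pow]
  refine Finset.sum_congr rfl fun x _ => ?_
  have h2 : (((ε x : ℤ) : ℂ)) ^ 2 = 1 := by
    rcases Int.units_eq_one_or (ε x) with h | h <;> simp [h]
  linear_combination (starRingEnd ℂ (c x)) ^ 2 * h1 +
    (((Real.sqrt (Fintype.card ι) : ℝ) : ℂ)⁻¹) ^ 2 * (starRingEnd ℂ (c x)) ^ 2 * h2

theorem sum_phaseKet_copies (c : ι → ℂ) (x y : Fin k → ι) :
    ∑ ε, starRingEnd ℂ (copies k (phaseKet c ε) x) * copies k (phaseKet c ε) y =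
      (((Real.sqrt (Fintype.card ι))⁻¹ : ℂ) ^ k) ^ 2 *
        (starRingEnd ℂ (∏ j, c (x j)) * ∏ j, c (y j)) *
        ∑ ε : ι → ℤˣ, (∏ j, ((ε (x j) : ℤ) : ℂ)) * ∏ j, ((ε (y j) : ℤ) : ℂ) := by
  rw [Finset.mul_sum]
  refine Finset.sum_congr rfl fun ε _ => ?_
  rw [phaseKet_copies_apply, phaseKet_copies_apply]
  simp only [map_mul, map_pow, map_inv₀, Complex.conj_ofReal, map_prod, map_intCast]
  ring

/-- On tuples without repetition the mixture of the states with given phases and random signs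
does not depend on the phases. -/
theorem sum_phaseKet_copies_eq {c : ι → ℂ} (hc : ∀ x, ‖c x‖ = 1) {x y : Fin k → ι}
    (hxy : Function.Injective x ∨ Function.Injective y) :
    ∑ ε, starRingEnd ℂ (copies k (phaseKet c ε) x) * copies k (phaseKet c ε) y =
      ∑ ε, starRingEnd ℂ (copies k (phaseKet 1 ε) x) * copies k (phaseKet 1 ε) y := by
  rw [sum_phaseKet_copies, sum_phaseKet_copies]
  by_cases h : ∀ z, (Even (occ x z) ↔ Even (occ y z))
  · have hocc : occ x = occ y := by
      rcases hxy with hx | hy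
      · exact occ_eq_of_parity hx h
      · exact (occ_eq_of_parity hy fun z => (h z).symm).symm
    have hn : ‖∏ j, c (y j)‖ = 1 := by simp [hc]
    rw [prod_eq_prod_pow_occ c x, hocc, ← prod_eq_prod_pow_occ c y, Complex.conj_mul', hn]
    simp
  · push Not at h
    obtain ⟨z, hz⟩ := h
    rw [sum_signs_eq_zero (z := z) (by tauto)]
    simp

/-- The part of a vector on tuples with a repetition. -/
noncomputable def repeatPart (φ : Ket (Fin k → ι)) : Ket (Fin k → ι) :=
  WithLp.toLp 2 fun x => if Function.Injective x then 0 else φ x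

/-- The two density matrices agree at every entry whose row or column is an injective tuple, so only
the block of repeating tuples contributes. -/
theorem sum_bornProb_sub {c : ι → ℂ} (hc : ∀ x, ‖c x‖ = 1)
    (E : Matrix (Fin k → ι) (Fin k → ι) ℂ) :
    ∑ ε, bornProb E (copies k (phaseKet 1 ε)) - ∑ ε, bornProb E (copies k (phaseKet c ε)) =
      ∑ ε, bornProb E (repeatPart (copies k (phaseKet 1 ε))) -
        ∑ ε, bornProb E (repeatPart (copies k (phaseKet c ε))) := by
  simp only [sum_bornProb, ← Complex.sub_re, ← Finset.sum_sub_distrib, ← mul_sub]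
  congr 1
  refine Finset.sum_congr rfl fun x _ => Finset.sum_congr rfl fun y _ => ?_
  congr 1
  by_cases hx : Function.Injective x
  · simp [repeatPart, hx, sum_phaseKet_copies_eq hc (Or.inl hx)]
  · by_cases hy : Function.Injective y
    · simp [repeatPart, hy, sum_phaseKet_copies_eq hc (Or.inr hy)]
    · simp [repeatPart, hx, hy]

/-- The birthday bound: a fraction at least `1 - k ^ 2 / d` of the `k`-tuples is injective, with
denominators cleared so that `d = 0` is allowed. -/
theorem descFactorial_lower_bound (d k : ℕ) :
    (d : ℝ) ^ k * (d - (k : ℝ) ^ 2) ≤ d.descFactorial k * d := by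
  induction k with
  | zero => simp
  | succ k ih =>
    rcases le_or_gt k d with hk | hk
    · rw [Nat.descFactorial_succ]
      push_cast [Nat.cast_sub hk]
      have hk' : (0 : ℝ) ≤ d - k := sub_nonneg.2 (by exact_mod_cast hk)
      have h := mul_le_mul_of_nonneg_left ih hk'
      -- This is the exact slack `d ^ k * ((d - k) * (d - k ^ 2) - d * (d - (k + 1) ^ 2))`.
      have h2 : (0 : ℝ) ≤ (d : ℝ) ^ k * ((k : ℝ) ^ 3 + d * (k + 1)) := by positivity
      rw [pow_succ]
      nlinarith
    · have h1 : (d : ℝ) ≤ k := by exact_mod_cast hk.le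
      have h2 : (d : ℝ) - ((k + 1 : ℕ) : ℝ) ^ 2 ≤ 0 := by
        push_cast
        nlinarith [(Nat.cast_nonneg k : (0 : ℝ) ≤ k)]
      exact (mul_nonpos_of_nonneg_of_nonpos (by positivity) h2).trans (by positivity)

/-- All amplitudes of the copies have equal modulus, so this squared norm is the fraction of tuples
with a repetition. -/
theorem norm_sq_repeatPart_le [Nonempty ι] {c : ι → ℂ} (hc : ∀ x, ‖c x‖ = 1) (ε : ι → ℤˣ) :
    ‖repeatPart (copies k (phaseKet c ε))‖ ^ 2 ≤ (k : ℝ) ^ 2 / Fintype.card ι := by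
  classical
  have hd : (0 : ℝ) < Fintype.card ι := by exact_mod_cast Fintype.card_pos
  have h1 : ∀ x, ‖repeatPart (copies k (phaseKet c ε)) x‖ ^ 2 =
      ((Fintype.card ι : ℝ) ^ k)⁻¹ -
        if Function.Injective x then ((Fintype.card ι : ℝ) ^ k)⁻¹ else 0 := by
    intro x
    by_cases hx : Function.Injective x
    · simp [repeatPart, hx]
    · rw [← norm_sq_phaseKet_copies_apply hc ε x]
      simp [repeatPart, hx]
  have hcard : ((Finset.univ.filter fun x : Fin k → ι => Function.Injective x).card : ℝ) =
      (Fintype.card ι).descFactorial k := by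
    rw [← Fintype.card_subtype, Fintype.card_congr (Equiv.subtypeInjectiveEquivEmbedding _ _),
      Fintype.card_embedding_eq, Fintype.card_fin]
  rw [EuclideanSpace.norm_sq_eq, Finset.sum_congr rfl fun x _ => h1 x, Finset.sum_sub_distrib,
    ← Finset.sum_filter, Finset.sum_const, Finset.sum_const, nsmul_eq_mul, nsmul_eq_mul, hcard,
    Finset.card_univ, Fintype.card_fun, Fintype.card_fin]
  have h2 := descFactorial_lower_bound (Fintype.card ι) k
  push_cast
  rw [le_div_iff₀ hd, mul_inv_cancel₀ (by positivity), ← div_eq_mul_inv, sub_mul, one_mul,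
    div_mul_eq_mul_div, sub_le_comm, le_div_iff₀ (by positivity)]
  linarith

end Signs

/-! ### The lower bound on the number of copies -/

section LowerBound

variable {n : ℕ}

/-- The phases `1` and `i`, according to the first bit. -/
noncomputable def quarterPhase (n : ℕ) [NeZero n] (x : Bits n) : ℂ :=
  if x 0 = 0 then 1 else Complex.I

theorem norm_quarterPhase [NeZero n] (x : Bits n) : ‖quarterPhase n x‖ = 1 := by
  unfold quarterPhase; split_ifs <;> simp

theorem sum_quarterPhase_sq [NeZero n] : ∑ x, quarterPhase n x ^ 2 = 0 := by
  have h01 : ∀ b : Fin 2, b = 0 ∨ b = 1 := by decide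
  -- Flipping the first bit pairs each square 1 with a square -1.
  refine Finset.sum_involution (fun x _ => Function.update x 0 (1 - x 0)) ?_ ?_ ?_ ?_
  · intro x _
    rcases h01 (x 0) with h | h <;> simp [quarterPhase, h]
  · intro x _ _ h
    have := congrFun h 0
    rcases h01 (x 0) with h | h <;> simp [h] at this
  · simp
  · intro x _
    simp

theorem Solves.lower_bound [NeZero n] {k : ℕ} {A : Algorithm (Fin k → Bits n)} {p : ℝ}
    (h : Solves A (copies k) p) : (2 * p - 1) * 2 ^ n ≤ (k : ℝ) ^ 2 := by
  have hcard : (Fintype.card (Bits n) : ℝ) = 2 ^ n := by simp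
  have h1 : ∀ x : Bits n, ‖(1 : Bits n → ℂ) x‖ = 1 := by simp
  have hq := norm_quarterPhase (n := n)
  have hpt : ∀ ε : Bits n → ℤˣ, 2 * p - 1 ≤
      bornProb A.yes (copies k (phaseKet 1 ε)) -
        bornProb A.yes (copies k (phaseKet (quarterPhase n) ε)) := by
    intro ε
    have hyes := (h _ (norm_phaseKet h1 ε)).1 (by
      rw [inner_conjKet_phaseKet]
      norm_num)
    have hno := (h _ (norm_phaseKet hq ε)).2 (by
      rw [inner_conjKet_phaseKet, sum_quarterPhase_sq]
      norm_num)
    have hnorm : ‖copies k (phaseKet (quarterPhase n) ε)‖ ^ 2 = 1 := by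
      rw [EuclideanSpace.norm_sq_eq,
        Finset.sum_congr rfl fun x _ => norm_sq_phaseKet_copies_apply hq ε x]
      simp
    rw [bornProb_one_sub, hnorm] at hno
    linarith
  have hsum := Finset.sum_le_sum fun ε (_ : ε ∈ Finset.univ) => hpt ε
  -- The passage to repeating tuples is made on the sum over all signs; the bound is then applied
  -- sign by sign.
  rw [Finset.sum_sub_distrib (fun ε => bornProb A.yes (copies k (phaseKet 1 ε))),
    sum_bornProb_sub hq, ← Finset.sum_sub_distrib] at hsum
  have hle : ∀ ε ∈ (Finset.univ : Finset (Bits n → ℤˣ)),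
      bornProb A.yes (repeatPart (copies k (phaseKet 1 ε))) -
        bornProb A.yes (repeatPart (copies k (phaseKet (quarterPhase n) ε))) ≤
      (k : ℝ) ^ 2 / 2 ^ n := by
    intro ε _
    have h2 := bornProb_nonneg A.yes_nonneg
      (repeatPart (copies k (phaseKet (quarterPhase n) ε)))
    have h3 := (A.bornProb_le _).trans (norm_sq_repeatPart_le (k := k) h1 ε)
    rw [hcard] at h3
    linarith
  have := hsum.trans (Finset.sum_le_sum hle)
  rw [Finset.sum_const, Finset.sum_const, nsmul_eq_mul, nsmul_eq_mul] at this
  have hpos : (0 : ℝ) < ((Finset.univ : Finset (Bits n → ℤˣ)).card : ℝ) := by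
    exact_mod_cast Finset.card_pos.2 Finset.univ_nonempty
  exact (le_div_iff₀ (by positivity)).1 (le_of_mul_le_mul_left this hpos)

end LowerBound

/-! ### The swap test and its acceptance probability -/

section SwapTest

variable {ι : Type} [Fintype ι] [DecidableEq ι]

theorem norm_conjKet (φ : Ket ι) : ‖conjKet φ‖ = ‖φ‖ := by
  simp [EuclideanSpace.norm_eq, conjKet]

theorem norm_tensorKet (φ χ : Ket ι) : ‖tensorKet φ χ‖ ^ 2 = ‖φ‖ ^ 2 * ‖χ‖ ^ 2 := by
  simp only [EuclideanSpace.norm_sq_eq, tensorKet, norm_mul, mul_pow, Fintype.sum_prod_type,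
    Finset.sum_mul_sum]

theorem toEuclideanLin_swapGate_tensorKet (φ χ : Ket ι) :
    Matrix.toEuclideanLin (swapGate ι) (tensorKet φ χ) = tensorKet χ φ := by
  ext ⟨a, b⟩
  have h : ∀ c : ι × ι, ((a, b) = c.swap) = (c = (b, a)) := by
    rintro ⟨c, d⟩
    simp only [Prod.swap_prod_mk, Prod.mk.injEq, eq_iff_iff]
    tauto
  simp [Matrix.toLpLin_apply, Matrix.mulVec, dotProduct, swapGate, tensorKet, h, mul_comm]

theorem inner_tensorKet (φ χ φ' χ' : Ket ι) :
    inner ℂ (tensorKet φ χ) (tensorKet φ' χ') = inner ℂ φ φ' * inner ℂ χ χ' := by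
  simp only [PiLp.inner_apply, RCLike.inner_apply, tensorKet, Fintype.sum_prod_type,
    Finset.sum_mul_sum, map_mul]
  refine Finset.sum_congr rfl fun x _ => Finset.sum_congr rfl fun y _ => ?_
  ring

theorem bornProb_smul (r : ℝ) (E : Matrix ι ι ℂ) (φ : Ket ι) :
    bornProb ((r : ℂ) • E) φ = r * bornProb E φ := by
  rw [bornProb, map_smul, LinearMap.smul_apply, inner_smul_right, Complex.re_ofReal_mul, bornProb]

/-- The swap test passes with probability `(1 + |⟨φ|χ⟩|²) / 2`. -/
theorem bornProb_swapTestPass {φ χ : Ket ι} (hφ : ‖φ‖ = 1) (hχ : ‖χ‖ = 1) :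
    bornProb (swapTestPass ι) (tensorKet φ χ) = (1 + ‖inner ℂ φ χ‖ ^ 2) / 2 := by
  have hhalf : (1 / 2 : ℂ) = ((1 / 2 : ℝ) : ℂ) := by norm_num
  have h1 : Matrix.toEuclideanLin (1 : Matrix (ι × ι) (ι × ι) ℂ) (tensorKet φ χ) =
      tensorKet φ χ := by
    ext x; simp
  rw [swapTestPass_eq, hhalf, bornProb_smul, bornProb, map_add, LinearMap.add_apply, h1,
    toEuclideanLin_swapGate_tensorKet, inner_add_right, inner_tensorKet, inner_tensorKet,
    inner_self_eq_norm_sq_to_K, inner_self_eq_norm_sq_to_K, hφ, hχ, ← inner_conj_symm χ φ,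
    Complex.mul_conj']
  norm_cast
  simp
  ring

theorem conjTranspose_swapGate : (swapGate ι).conjTranspose = swapGate ι := by
  ext a b
  have : b = a.swap ↔ a = b.swap := by constructor <;> (rintro rfl; simp)
  simp [swapGate, this, apply_ite]

theorem swapGate_mul_self : swapGate ι * swapGate ι = 1 := by
  ext a b
  simp [swapGate, Matrix.mul_apply, Matrix.one_apply]

/-- SWAP is a self-adjoint involution, so `(1 + SWAP) / 2` is an orthogonal projection `P = P† P`.
-/
theorem posSemidef_swapTestPass : (swapTestPass ι).PosSemidef := by
  have h : swapTestPass ι = (swapTestPass ι).conjTranspose * swapTestPass ι := by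
    rw [swapTestPass_eq]
    simp only [Matrix.conjTranspose_smul, Matrix.conjTranspose_add, conjTranspose_swapGate,
      Matrix.conjTranspose_one, smul_mul_smul_comm, add_mul, mul_add, swapGate_mul_self,
      one_mul, mul_one]
    ext a b
    simp
    ring
  rw [h]
  exact Matrix.posSemidef_conjTranspose_mul_self _

theorem posSemidef_one_sub_swapTestPass : (1 - swapTestPass ι).PosSemidef := by
  have h : 1 - swapTestPass ι = (1 - swapTestPass ι).conjTranspose * (1 - swapTestPass ι) := by
    rw [swapTestPass_eq]
    simp only [Matrix.conjTranspose_sub, Matrix.conjTranspose_smul, Matrix.conjTranspose_add,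
      conjTranspose_swapGate, Matrix.conjTranspose_one, sub_mul, mul_sub, smul_mul_smul_comm,
      add_mul, mul_add, swapGate_mul_self, one_mul, mul_one]
    ext a b
    simp
    ring
  rw [h]
  exact Matrix.posSemidef_conjTranspose_mul_self _

/-- The algorithm that runs the swap test and, if it passes, answers yes with probability `s`. -/
noncomputable def swapTestAlgorithm (ι : Type) [Fintype ι] [DecidableEq ι] (s : ℝ)
    (hs : s ∈ Set.Icc (0 : ℝ) 1) : Algorithm (ι × ι) where
  yes := (s : ℂ) • swapTestPass ι
  yes_nonneg := posSemidef_swapTestPass.smul (by exact_mod_cast hs.1)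
  yes_le_one := by
    have h : 1 - (s : ℂ) • swapTestPass ι =
        (1 - swapTestPass ι) + ((1 - s : ℝ) : ℂ) • swapTestPass ι := by
      push_cast
      module
    rw [h]
    exact posSemidef_one_sub_swapTestPass.add
      (posSemidef_swapTestPass.smul (by exact_mod_cast sub_nonneg.2 hs.2))

theorem bornProb_swapTestAlgorithm {s : ℝ} (hs : s ∈ Set.Icc (0 : ℝ) 1) {ψ : Ket ι}
    (hψ : ‖ψ‖ = 1) :
    bornProb (swapTestAlgorithm ι s hs).yes (tensorKet ψ (conjKet ψ)) =
      s * ((1 + ‖inner ℂ ψ (conjKet ψ)‖ ^ 2) / 2) := by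
  rw [swapTestAlgorithm, bornProb_smul,
    bornProb_swapTestPass hψ ((norm_conjKet ψ).trans hψ)]

end SwapTest

end ConjOverlap

theorem mainTheorem3 :
    (∀ p : ℝ, 1 / 2 < p → ∃ c : ℝ, 0 < c ∧
      ∀ n : ℕ, 1 ≤ n → ∀ (k : ℕ) (A : ConjOverlap.Algorithm (Fin k → ConjOverlap.Bits n)),
        ConjOverlap.Solves A (ConjOverlap.copies k) p →
          c * (2 : ℝ) ^ ((n : ℝ) / 2) ≤ (k : ℝ)) ∧
    (∃ p : ℝ, 1 / 2 < p ∧ ∃ s ∈ Set.Icc (0 : ℝ) 1, ∃ t ∈ Set.Icc (0 : ℝ) 1,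
      ∀ n : ℕ, ∃ A : ConjOverlap.Algorithm (ConjOverlap.Bits n × ConjOverlap.Bits n),
        ConjOverlap.IsSwapTestAlgorithm A s t ∧
        ConjOverlap.Solves A
          (fun ψ => ConjOverlap.tensorKet ψ (ConjOverlap.conjKet ψ)) p) := by
  constructor
  · intro p hp
    have hp' : 0 < 2 * p - 1 := by linarith
    -- The square root of `(2 * p - 1) * 2 ^ n ≤ k ^ 2` gives this constant.
    refine ⟨Real.sqrt (2 * p - 1), Real.sqrt_pos.2 hp', fun n hn k A hA => ?_⟩
    have : NeZero n := ⟨by omega⟩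
    have h := hA.lower_bound
    refine (pow_le_pow_iff_left₀ (by positivity) (Nat.cast_nonneg k) two_ne_zero).1 ?_
    rw [mul_pow, Real.sq_sqrt hp'.le, ← Real.rpow_natCast ((2 : ℝ) ^ ((n : ℝ) / 2)),
      ← Real.rpow_mul (by norm_num)]
    have h2 : (n : ℝ) / 2 * ((2 : ℕ) : ℝ) = n := by push_cast; ring
    rwa [h2, Real.rpow_natCast]
  · have hs : (18 / 23 : ℝ) ∈ Set.Icc (0 : ℝ) 1 := by constructor <;> norm_num
    -- The test passes with probability at least 13/18 on yes instances and at most 10/18 on no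
    -- instances. With `t = 0`, balancing `s * 13/18 = 1 - s * 10/18` gives `s = 18/23` and success
    -- probability 13/23.
    refine ⟨13 / 23, by norm_num, 18 / 23, hs, 0, by simp, fun n =>
      ⟨ConjOverlap.swapTestAlgorithm _ (18 / 23) hs, ?_, ?_⟩⟩
    · simp [ConjOverlap.IsSwapTestAlgorithm, ConjOverlap.swapTestAlgorithm]
    · intro ψ hψ
      have hnorm : ‖ConjOverlap.tensorKet ψ (ConjOverlap.conjKet ψ)‖ ^ 2 = 1 := by
        rw [ConjOverlap.norm_tensorKet, ConjOverlap.norm_conjKet, hψ]; norm_num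
      rw [ConjOverlap.bornProb_one_sub, hnorm, ConjOverlap.bornProb_swapTestAlgorithm hs hψ]
      have h0 := norm_nonneg (inner ℂ ψ (ConjOverlap.conjKet ψ))
      constructor <;> intro h <;> nlinarith
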